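/- **Conventions.** All graphs are finite. A graph is a set of nodes with a set $E$ of ordered pairs of nodes; $a-b$ is an undirected edge if $(a,b),(b,a)\in E$, and $a\to b$ is a directed edge if $(a,b)\in E$ and $(b,a)\notin E$. $Dir(H)$ is the set of directed edges of $H$, $H[S]$ is the subgraph induced on $S$, and $\mathcal C(H)$ is the set of (node sets of) chain components of $H$, i.e. the connected components left after removing all directed edges. A v-structure is an induced subgraph $a\to b\leftarrow c$. For a DAG $D$ and a node set $I$, $D^{(I)}$ is $D$ with all edges directed towards nodes of $I$ removed. For a family $\mathcal I$ of node sets, two DAGs $D_1,D_2$ on the same nodes are $\mathcal I$-Markov equivalent if they have the same v-structures and $D_1^{(I)},D_2^{(I)}$ have the same skeleton for every $I\in\mathcal I\cup\{\emptyset\}$. $MEC_{\mathcal I}(D)$ is the set of DAGs $\mathcal I$-Markov equivalent to $D$, and the $\mathcal I$-essential graph $\mathcal E_{\mathcal I}(D)$ has the nodes of $D$ and as edge set the union of the edge sets of the DAGs in $MEC_{\mathcal I}(D)$. For an undirected graph $H$, $\mathbf D(H)$ is the set of DAGs $D$ with $\mathcal E_{\emptyset}(D)=H$, and $\mathcal{IR}_{\mathcal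 I}(H)=\{\mathcal E_{\mathcal I}(D): D\in\mathbf D(H)\}$. For a node set $T=\{v_1,\dots,v_t\}$ write $\mathcal I_T=\{\{v_1\},\dots,\{v_t\}\}$. **Statement.** Let $G$ be an undirected chordal graph on $V$. For $T\subseteq S\subseteq V$ put $$DP[S][T]=\min_{D\in\mathbf D(G[S])}|Dir(\mathcal E_{\mathcal I_T}(D))|,\qquad DP'[S][T]=\max_{D\in\mathbf D(G[S])}|MEC_{\mathcal I_T}(D)|.$$ Then for all $T\subseteq S\subseteq V$ and every $v_1\in T$, the set $\mathcal{IR}_{\{\{v_1\}\}}(G[S])$ is non-empty and $$DP[S][T]=\min_{R\in\mathcal{IR}_{\{\{v_1\}\}}(G[S])}\Big\{|Dir(R)|+\sum_{C\in\mathcal C(R)}DP[C][T\cap C]\Big\},$$ $$DP'[S][T]=\max_{R\in\mathcal{IR}_{\{\{v_1\}\}}(G[S])}\ \prod_{C\in\mathcal C(R)}DP'[C][T\cap C].$$ Moreover, let $S=V$, or let $S$ be obtained from $V$ by repeatedly replacing the current set $S'$ by a chain component of some $R\in\mathcal{IR}_{\{\{v\}\}}(G[S'])$ with $v\in S'$.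 Then $\mathbf D(G[S])=\{D[S]:D\in\mathbf D(G)\}$, so that for such $S$ the minimum and the maximum above may equivalently be taken over the graphs $D[S]$ with $D\in\mathbf D(G)$. -/

import Mathlib

open Finset

/-- A (partially directed) graph: a finite node set and a set of ordered pairs of nodes.
There is an undirected edge between `a` and `b` if both `(a, b)` and `(b, a)` are edges,
and a directed edge `a → b` if `(a, b)` is an edge and `(b, a)` is not. -/
@[ext]
structure MixedGraph (V : Type*) where
  verts : Finset V
  edge : V → V → Prop
  left_mem : ∀ {a b}, edge a b → a ∈ verts
  right_mem : ∀ {a b}, edge a b → b ∈ verts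

namespace MixedGraph

variable {V : Type*}

/-- The undirected graph `G` as a mixed graph on all of `V`. -/
def ofGraph [Fintype V] (G : SimpleGraph V) : MixedGraph V where
  verts := Finset.univ
  edge := G.Adj
  left_mem _ := Finset.mem_univ _
  right_mem _ := Finset.mem_univ _

/-- The induced subgraph `H[S]`. -/
def induce [DecidableEq V] (H : MixedGraph V) (S : Finset V) : MixedGraph V where
  verts := H.verts ∩ S
  edge a b := H.edge a b ∧ a ∈ S ∧ b ∈ S
  left_mem h := Finset.mem_inter.mpr ⟨H.left_mem h.1, h.2.1⟩
  right_mem h := Finset.mem_inter.mpr ⟨H.right_mem h.1, h.2.2⟩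

/-- The skeleton: every directed edge is replaced by an undirected one. -/
def skeleton (H : MixedGraph V) : MixedGraph V where
  verts := H.verts
  edge a b := H.edge a b ∨ H.edge b a
  left_mem h := h.elim H.left_mem H.right_mem
  right_mem h := h.elim H.right_mem H.left_mem

/-- `a → b` is a directed edge. -/
def Directed (H : MixedGraph V) (a b : V) : Prop := H.edge a b ∧ ¬ H.edge b a

/-- `a - b` is an undirected edge. -/
def Undirected (H : MixedGraph V) (a b : V) : Prop := H.edge a b ∧ H.edge b a

/-- The set `Dir(H)` of directed edges. -/
def Dir (H : MixedGraph V) : Set (V × V) := {p | H.Directed p.1 p.2}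

/-- The node sets of the chain components: the connected components left after all directed edges
are removed. -/
noncomputable def chainComponents [DecidableEq V] (H : MixedGraph V) : Finset (Finset V) :=
  open Classical in
  H.verts.image fun a => H.verts.filter fun b => Relation.ReflTransGen H.Undirected a b

/-- `D` is a directed acyclic graph. No closed walk exists, so in particular there are no loops and
no undirected edges. -/
def IsDAG (D : MixedGraph V) : Prop := ∀ a, ¬ Relation.TransGen D.edge a a

/-- The v-structures of `D`: triples `(a, b, c)` such that the subgraph of `D` induced on them
is `a → b ← c`. -/
def vStructures (D : MixedGraph V) : Set (V × V × V) :=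
  {t | t.1 ≠ t.2.2 ∧ D.Directed t.1 t.2.1 ∧ D.Directed t.2.2 t.2.1 ∧
    ¬ D.edge t.1 t.2.2 ∧ ¬ D.edge t.2.2 t.1}

/-- The intervention graph: all edges directed towards nodes of `I` are removed. -/
def intervene (D : MixedGraph V) (I : Set V) : MixedGraph V where
  verts := D.verts
  edge a b := D.edge a b ∧ b ∉ I
  left_mem h := D.left_mem h.1
  right_mem h := D.right_mem h.1

/-- Interventional Markov equivalence of DAGs on the same nodes, for the intervention family `𝓘`:
the same v-structures, and intervention graphs with the same skeleton for every target in
`𝓘 ∪ {∅}`. For `𝓘 = ∅` this is Markov equivalence. -/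
def IEquiv (𝓘 : Set (Set V)) (D₁ D₂ : MixedGraph V) : Prop :=
  D₁.verts = D₂.verts ∧ D₁.vStructures = D₂.vStructures ∧
    ∀ I ∈ 𝓘 ∪ {∅}, (D₁.intervene I).skeleton = (D₂.intervene I).skeleton

/-- The interventional Markov equivalence class of `D`. -/
def IMEC (𝓘 : Set (Set V)) (D : MixedGraph V) : Set (MixedGraph V) :=
  {D' | D'.IsDAG ∧ IEquiv 𝓘 D D'}

/-- The interventional essential graph of `D`: the union of the DAGs equivalent to `D`. -/
def essentialGraph (𝓘 : Set (Set V)) (D : MixedGraph V) : MixedGraph V where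
  verts := D.verts
  edge a b := ∃ D' ∈ IMEC 𝓘 D, D'.edge a b
  left_mem := by
    rintro a b ⟨D', hD', h⟩
    rw [hD'.2.1]
    exact D'.left_mem h
  right_mem := by
    rintro a b ⟨D', hD', h⟩
    rw [hD'.2.1]
    exact D'.right_mem h

/-- The DAGs in the Markov equivalence class corresponding to `H`: those whose (observational)
essential graph is `H`. -/
def dags (H : MixedGraph V) : Set (MixedGraph V) :=
  {D | D.IsDAG ∧ essentialGraph ∅ D = H}

/-- The intervention result space of `H`. -/
def resultSpace (𝓘 : Set (Set V)) (H : MixedGraph V) : Set (MixedGraph V) :=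
  essentialGraph 𝓘 '' H.dags

/-- The family of single-node targets `{v}` with `v ∈ T`. -/
def singleNodes (T : Finset V) : Set (Set V) := {I | ∃ v ∈ T, I = {v}}

end MixedGraph

open MixedGraph

/-- Every cycle of length at least four has a chord: an edge that joins two of its nodes
and is not one of its edges. -/
def SimpleGraph.HasChords {V : Type*} (G : SimpleGraph V) : Prop :=
  ∀ (u : V) (p : G.Walk u u), p.IsCycle → 4 ≤ p.length →
    ∃ a ∈ p.support, ∃ b ∈ p.support, G.Adj a b ∧ s(a, b) ∉ p.edges

/-- The induced subgraph `G[S]` as a mixed graph. -/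
def inducedGraph {V : Type*} [Fintype V] [DecidableEq V] (G : SimpleGraph V) (S : Finset V) :
    MixedGraph V :=
  (ofGraph G).induce S

/-- The least number of directed edges in the interventional essential graph that results from
intervening on each node of `T` separately, over the DAGs of `G[S]`. -/
noncomputable def dpDir {V : Type*} [Fintype V] [DecidableEq V] (G : SimpleGraph V)
    (S T : Finset V) : ℕ :=
  sInf ((fun D => (essentialGraph (singleNodes T) D).Dir.ncard) '' (inducedGraph G S).dags)

/-- The greatest size of an interventional Markov equivalence class that results from
intervening on each node of `T` separately, over the DAGs of `G[S]`. -/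
noncomputable def dpMEC {V : Type*} [Fintype V] [DecidableEq V] (G : SimpleGraph V)
    (S T : Finset V) : ℕ :=
  sSup ((fun D => (IMEC (singleNodes T) D).ncard) '' (inducedGraph G S).dags)

/-- The node sets reached from the whole of `V` by repeatedly intervening on a single node
and passing to a chain component of a result. -/
inductive Arises {V : Type*} [Fintype V] [DecidableEq V] (G : SimpleGraph V) : Finset V → Prop
  | univ : Arises G Finset.univ
  | step {S C : Finset V} {v : V} {R : MixedGraph V} (hS : Arises G S) (hv : v ∈ S)
      (hR : R ∈ resultSpace {{v}} (inducedGraph G S)) (hC : C ∈ R.chainComponents) : Arises G C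

/-! For chordal `G`, the DAGs whose essential graph is `G[S]` are exactly the acyclic moral
orientations of `G[S]` (`mem_dags_inducedGraph_iff`), because every node is a source of such an
orientation. Two of them are equivalent for single-node targets iff they agree on the edges at the
targets (`IsAMO.iEquiv_iff`).

The core is that the essential graph `R` of such a `D` is a chain graph whose components can be
oriented independently. Closing the orientations at the targets under two Meek rules gives a chain
graph (`Forced.of_not_forced`): a forced parent of one node of a component is a parent of the whole
component. Hence arbitrary acyclic moral orientations of the components glue to one of `G[S]`
(`IsChainGraph.glue_isAMO`), which lies in the class of `D`. Chordality then lets each unforced edge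
point either way, so `R` is this closure (`essentialGraph_eq_forcedGraph`).

For `U ⊆ T`, gluing and restriction make the class for `T` a product over the components of the
essential graph for `U`, and its directed edges a disjoint union (`ncard_IMEC`, `ncard_Dir`). As the
components are chosen independently, minimum and maximum split accordingly; the statement is the
case `U = {v₁}`. Iterated gluing also extends an orientation of an arising node set to all of `G`,
while restriction to any node set preserves moral acyclicity. -/

/-! ### Chordal graphs: simplicial nodes and elimination orderings -/

namespace SimpleGraph

variable {V : Type*} {G : SimpleGraph V}

/-- A walk through the two ends of an edge that is not one of its edges can be shortened. -/
theorem Walk.exists_shorter {x y a b : V} (p : G.Walk x y) (ha : a ∈ p.support)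
    (hb : b ∈ p.support) (hab : G.Adj a b) (he : s(a, b) ∉ p.edges) :
    ∃ q : G.Walk x y, q.length < p.length ∧ q.support ⊆ p.support := by
  classical
  have two_le : ∀ {c d : V} (q : G.Walk c d), c ≠ d → s(c, d) ∉ q.edges → 2 ≤ q.length := by
    intro c d q hcd hq
    match q with
    | .nil => exact absurd rfl hcd
    | .cons h .nil => simp at hq
    | .cons h (.cons h' r) => simp
  have key : ∀ {c d : V} (p₁ : G.Walk x c) (p₂ : G.Walk c y), p = p₁.append p₂ → G.Adj c d →
      d ∈ p₂.support → s(c, d) ∉ p.edges →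
      ∃ q : G.Walk x y, q.length < p.length ∧ q.support ⊆ p.support := by
    rintro c d p₁ p₂ rfl hcd hd hq
    refine ⟨p₁.append (.cons hcd (p₂.dropUntil d hd)), ?_, ?_⟩
    · have h₂ := congrArg Walk.length (p₂.take_spec hd)
      have h₃ := two_le (p₂.takeUntil d hd) hcd.ne fun h => hq <| by
        rw [Walk.edges_append, List.mem_append]
        exact Or.inr (p₂.edges_takeUntil_subset_edges hd h)
      simp only [Walk.length_append, Walk.length_cons] at *
      omega
    · intro w hw
      rw [Walk.mem_support_append_iff, Walk.support_cons, List.mem_cons] at hw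
      rw [Walk.mem_support_append_iff]
      rcases hw with hw | rfl | hw
      · exact Or.inl hw
      · exact Or.inr p₂.start_mem_support
      · exact Or.inr (p₂.support_dropUntil_subset_support hd hw)
  -- `key` assumes that `c` comes before `d` on the walk; split by which of `a` and `b` comes first.
  have hb' := hb
  rw [← p.take_spec ha, Walk.mem_support_append_iff] at hb'
  rcases hb' with h | h
  · refine key ((p.takeUntil a ha).takeUntil b h)
      (((p.takeUntil a ha).dropUntil b h).append (p.dropUntil a ha)) ?_ hab.symm ?_
      (by rwa [Sym2.eq_swap])
    · rw [Walk.append_assoc, Walk.take_spec, Walk.take_spec]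
    · exact (Walk.mem_support_append_iff ..).2 (Or.inr (Walk.start_mem_support _))
  · exact key _ _ (p.take_spec ha).symm hab h he

/-- In a chordal graph, two neighbours of `v` that are joined by a walk outside the closed
neighbourhood of `v` are adjacent. -/
theorem HasChords.adj_of_walk (hG : G.HasChords) {v x y : V} (hx : G.Adj v x) (hy : G.Adj v y)
    (hxy : x ≠ y) (p : G.Walk x y)
    (hp : ∀ w ∈ p.support, w ≠ x → w ≠ y → w ≠ v ∧ ¬ G.Adj v w) : G.Adj x y := by
  classical
  induction hn : p.length using Nat.strong_induction_on generalizing p with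
  | _ n ih =>
  subst hn
  by_contra hnadj
  have hq : ∀ w ∈ p.bypass.support, w ≠ x → w ≠ y → w ≠ v ∧ ¬ G.Adj v w := fun w hw =>
    hp w (p.support_bypass_subset_support hw)
  have hlen := p.length_bypass_le_length
  have hpath := p.bypass_isPath
  generalize p.bypass = q at hq hlen hpath
  have hv : v ∉ q.support := fun h => (hq v h hx.ne hy.ne).1 rfl
  -- Close the path through `v` to a cycle. A chord cannot end at `v`, whose only neighbours on the
  -- path are `x` and `y`, so it shortens the path and the induction on length applies.
  have hcyc : (Walk.cons hx (q.concat hy.symm)).IsCycle := by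
    rw [Walk.cons_isCycle_iff]
    refine ⟨hpath.concat hv _, ?_⟩
    rw [Walk.edges_concat, List.concat_eq_append, List.mem_append]
    rintro (h | h)
    · exact hv (q.fst_mem_support_of_mem_edges h)
    · simp only [List.mem_singleton, Sym2.eq_iff] at h
      rcases h with h | h
      · exact hy.ne h.1
      · exact hxy h.2
  have hlong : 4 ≤ (Walk.cons hx (q.concat hy.symm)).length := by
    simp only [Walk.length_cons, Walk.length_concat]
    match q with
    | .nil => exact absurd rfl hxy
    | .cons h .nil => exact absurd h hnadj
    | .cons h (.cons h' r) => simp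
  obtain ⟨a, ha, b, hb, hab, he⟩ := hG v _ hcyc hlong
  simp only [Walk.support_cons, Walk.support_concat, List.mem_cons,
    List.mem_append, List.not_mem_nil, or_false] at ha hb
  simp only [Walk.edges_cons, Walk.edges_concat, List.concat_eq_append, List.mem_cons,
    List.mem_append, List.not_mem_nil, or_false, not_or] at he
  have hend : ∀ c, G.Adj v c → s(v, c) ≠ s(v, x) → s(v, c) ≠ s(y, v) → c ∉ q.support := by
    intro c hc h₁ h₂ hcq
    by_cases hcx : c = x
    · exact h₁ (by rw [hcx])
    by_cases hcy : c = y
    · exact h₂ (by rw [hcy, Sym2.eq_swap])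
    exact (hq c hcq hcx hcy).2 hc
  by_cases hav : a = v
  · subst hav
    have hbq : b ∈ q.support := by
      rcases hb with h | h | h
      · exact absurd h hab.ne'
      · exact h
      · exact absurd h hab.ne'
    exact hend b hab he.1 he.2.2 hbq
  by_cases hbv : b = v
  · subst hbv
    have haq : a ∈ q.support := by
      rcases ha with h | h | h
      · exact absurd h hav
      · exact h
      · exact absurd h hav
    exact hend a hab.symm (by rw [Sym2.eq_swap]; exact he.1) (by rw [Sym2.eq_swap]; exact he.2.2) haq
  obtain ⟨r, hr, hrs⟩ := q.exists_shorter (by tauto) (by tauto) hab he.2.1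
  exact hnadj (ih r.length (by omega) r (fun w hw => hq w (hrs hw)) rfl)

/-- The neighbours of `w` in `S` are pairwise adjacent. -/
def IsSimplicialIn (G : SimpleGraph V) (S : Finset V) (w : V) : Prop :=
  ∀ ⦃a⦄, a ∈ S → ∀ ⦃b⦄, b ∈ S → G.Adj w a → G.Adj w b → a ≠ b → G.Adj a b

/-- A node that is not adjacent to all the others has a simplicial non-neighbour. -/
theorem HasChords.exists_simplicial_not_adj (hG : G.HasChords) (S : Finset V) {v u : V}
    (hu : u ∈ S) (huv : u ≠ v) (hvu : ¬ G.Adj v u) (hv : v ∈ S) :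
    ∃ w ∈ S, w ≠ v ∧ ¬ G.Adj v w ∧ G.IsSimplicialIn S w := by
  classical
  induction S using Finset.strongInduction generalizing v u with
  | _ S ih =>
  -- Dirac's argument: `C` is the component of `u` in `S` outside the closed neighbourhood of `v`,
  -- and `N` consists of the neighbours of `v` attached to `C`. `N` is a clique, and `C` has no
  -- neighbours in `S` outside `C ∪ N`, so a node of `C` that is simplicial in `C ∪ N` suffices.
  set r : V → V → Prop := fun a b => G.Adj a b ∧ b ∈ S ∧ b ≠ v ∧ ¬ G.Adj v b with hr
  set C : Finset V := S.filter fun b => Relation.ReflTransGen r u b with hC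
  have hCmem : ∀ {c}, Relation.ReflTransGen r u c → c ∈ S ∧ c ≠ v ∧ ¬ G.Adj v c := by
    intro c hc
    induction hc with
    | refl => exact ⟨hu, huv, hvu⟩
    | tail _ h _ => exact h.2
  have hwalk : ∀ {c}, Relation.ReflTransGen r u c →
      ∃ p : G.Walk u c, ∀ w ∈ p.support, w ≠ v ∧ ¬ G.Adj v w := by
    intro c hc
    induction hc with
    | refl => exact ⟨.nil, by simp [huv, hvu]⟩
    | tail _ h ih =>
      obtain ⟨p, hp⟩ := ih
      refine ⟨p.concat h.1, fun w hw => ?_⟩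
      rw [Walk.support_concat, List.mem_append, List.mem_singleton] at hw
      rcases hw with hw | rfl
      · exact hp w hw
      · exact h.2.2
  set N : Finset V := S.filter fun s => G.Adj v s ∧ ∃ c ∈ C, G.Adj c s with hN
  have hclique : ∀ x ∈ N, ∀ y ∈ N, x ≠ y → G.Adj x y := by
    intro x hx y hy hxy
    obtain ⟨-, hvx, c, hc, hcx⟩ := mem_filter.1 hx
    obtain ⟨-, hvy, d, hd, hdy⟩ := mem_filter.1 hy
    obtain ⟨p, hp⟩ := hwalk (mem_filter.1 hc).2
    obtain ⟨q, hq⟩ := hwalk (mem_filter.1 hd).2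
    refine hG.adj_of_walk hvx hvy hxy (.cons hcx.symm ((p.reverse.append q).concat hdy)) ?_
    intro w hw hwx hwy
    simp only [Walk.support_cons, Walk.support_concat, List.mem_cons,
      List.mem_append, Walk.mem_support_append_iff, Walk.support_reverse, List.mem_reverse,
      List.not_mem_nil, or_false] at hw
    rcases hw with h | (h | h) | h
    · exact absurd h hwx
    · exact hp w h
    · exact hq w h
    · exact absurd h hwy
  have huC : u ∈ C := mem_filter.2 ⟨hu, .refl⟩
  have hnbr : ∀ c ∈ C, ∀ a ∈ S, G.Adj c a → a ∈ C ∪ N := by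
    intro c hc a ha hca
    by_cases hva : G.Adj v a
    · exact mem_union_right _ (mem_filter.2 ⟨ha, hva, c, hc, hca⟩)
    · have hcr := (mem_filter.1 hc).2
      refine mem_union_left _ (mem_filter.2 ⟨ha, hcr.tail ⟨hca, ha, ?_, hva⟩⟩)
      rintro rfl
      exact (hCmem hcr).2.2 hca.symm
  suffices h : ∃ w ∈ C, G.IsSimplicialIn (C ∪ N) w by
    obtain ⟨w, hw, hws⟩ := h
    have := hCmem (mem_filter.1 hw).2
    exact ⟨w, this.1, this.2.1, this.2.2, fun a ha b hb hwa hwb =>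
      hws (hnbr w hw a ha hwa) (hnbr w hw b hb hwb) hwa hwb⟩
  have hss : C ∪ N ⊂ S := by
    refine (ssubset_iff_of_subset (union_subset (filter_subset _ _) (filter_subset _ _))).2
      ⟨v, hv, fun h => ?_⟩
    rcases mem_union.1 h with h | h
    · exact (hCmem (mem_filter.1 h).2).2.1 rfl
    · exact (mem_filter.1 h).2.1.ne rfl
  -- Recurse in `C ∪ N` with `s` in the role of `v`. The simplicial node found is not adjacent to
  -- `s`, which keeps it out of the clique `N`.
  by_cases h₁ : ∃ s ∈ N, ∃ t ∈ C ∪ N, t ≠ s ∧ ¬ G.Adj s t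
  · obtain ⟨s, hs, t, ht, hts, hst⟩ := h₁
    obtain ⟨w, hw, hws, hsw, hsimp⟩ := ih _ hss ht hts hst (mem_union_right _ hs)
    refine ⟨w, (mem_union.1 hw).resolve_right fun h => hsw (hclique s hs w h hws.symm), hsimp⟩
  push Not at h₁
  -- Now nodes of `N` are adjacent to all of `C ∪ N`, so a non-neighbour of `s` is again in `C`. If
  -- no such `s` exists, `C ∪ N` is complete and `u` itself will do.
  by_cases h₂ : ∃ s ∈ C, ∃ t ∈ C ∪ N, t ≠ s ∧ ¬ G.Adj s t
  · obtain ⟨s, hs, t, ht, hts, hst⟩ := h₂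
    obtain ⟨w, hw, hws, hsw, hsimp⟩ := ih _ hss ht hts hst (mem_union_left _ hs)
    exact ⟨w, (mem_union.1 hw).resolve_right fun h =>
      hsw (h₁ w h s (mem_union_left _ hs) hws.symm).symm, hsimp⟩
  push Not at h₂
  refine ⟨u, huC, fun a ha b hb _ _ hab => ?_⟩
  rcases mem_union.1 ha with h | h
  · exact h₂ a h b hb hab.symm
  · exact h₁ a h b hb hab.symm

/-- Every node set of a chordal graph has a simplicial node other than a given one. -/
theorem HasChords.exists_simplicial_ne (hG : G.HasChords) {S : Finset V} {v w : V} (hv : v ∈ S)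
    (hw : w ∈ S) (hwv : w ≠ v) : ∃ w ∈ S, w ≠ v ∧ G.IsSimplicialIn S w := by
  by_cases h₁ : ∃ u ∈ S, u ≠ v ∧ ¬ G.Adj v u
  · obtain ⟨u, hu, huv, hvu⟩ := h₁
    obtain ⟨x, hx, hxv, -, hs⟩ := hG.exists_simplicial_not_adj S hu huv hvu hv
    exact ⟨x, hx, hxv, hs⟩
  push Not at h₁
  by_cases h₂ : ∃ s ∈ S, ∃ u ∈ S, u ≠ s ∧ ¬ G.Adj s u
  · obtain ⟨s, hs, u, hu, hus, hsu⟩ := h₂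
    obtain ⟨x, hx, hxs, hsx, hsimp⟩ := hG.exists_simplicial_not_adj S hu hus hsu hs
    refine ⟨x, hx, ?_, hsimp⟩
    rintro rfl
    exact hsx (h₁ s hs hxs.symm).symm
  push Not at h₂
  exact ⟨w, hw, hwv, fun a ha b hb _ _ hab => h₂ a ha b hb hab.symm⟩

/-- Every node set of a chordal graph has the reverse of a perfect elimination ordering that
starts at a given node. -/
theorem HasChords.exists_ordering (hG : G.HasChords) (S : Finset V) {v : V} (hv : v ∈ S) :
    ∃ r : V → ℕ, (∀ a ∈ S, a ≠ v → r v < r a) ∧ Set.InjOn r S ∧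
      ∀ a ∈ S, ∀ b ∈ S, ∀ c ∈ S, G.Adj a b → G.Adj c b → r a < r b → r c < r b → a ≠ c →
        G.Adj a c := by
  classical
  induction S using Finset.strongInduction with
  | _ S ih =>
  by_cases h : ∃ w ∈ S, w ≠ v
  · obtain ⟨w, hw, hwv⟩ := h
    obtain ⟨x, hx, hxv, hs⟩ := hG.exists_simplicial_ne hv hw hwv
    obtain ⟨r, h₁, h₂, h₃⟩ := ih _ (erase_ssubset hx) (mem_erase.2 ⟨hxv.symm, hv⟩)
    have hlt : ∀ a ∈ S, r a < S.sup r + 1 := fun a ha => Nat.lt_succ_of_le (le_sup ha)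
    -- The simplicial node `x` is ranked above all others; since `x ≠ v` at every stage, `v` ends up
    -- lowest.
    refine ⟨Function.update r x (S.sup r + 1), ?_, ?_, ?_⟩
    · intro a ha hav
      rw [Function.update_of_ne hxv.symm]
      by_cases hax : a = x
      · rw [hax, Function.update_self]
        exact hlt v hv
      · rw [Function.update_of_ne hax]
        exact h₁ a (mem_erase.2 ⟨hax, ha⟩) hav
    · intro a ha b hb hab
      by_cases hax : a = x <;> by_cases hbx : b = x
      · rw [hax, hbx]
      · rw [hax, Function.update_self, Function.update_of_ne hbx] at hab
        exact absurd hab (hlt b hb).ne'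
      · rw [hbx, Function.update_self, Function.update_of_ne hax] at hab
        exact absurd hab (hlt a ha).ne
      · rw [Function.update_of_ne hax, Function.update_of_ne hbx] at hab
        exact h₂ (mem_coe.2 (mem_erase.2 ⟨hax, ha⟩)) (mem_coe.2 (mem_erase.2 ⟨hbx, hb⟩)) hab
    · intro a ha b hb c hc hab hcb hra hrc hac
      by_cases hbx : b = x
      · subst hbx
        exact hs ha hc hab.symm hcb.symm hac
      have hne : ∀ d ∈ S, Function.update r x (S.sup r + 1) d <
          Function.update r x (S.sup r + 1) b → d ≠ x := by
        rintro d - hlt' rfl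
        rw [Function.update_self, Function.update_of_ne hbx] at hlt'
        exact absurd (hlt b hb) (by omega)
      have hax := hne a ha hra
      have hcx := hne c hc hrc
      rw [Function.update_of_ne hax, Function.update_of_ne hbx] at hra
      rw [Function.update_of_ne hcx, Function.update_of_ne hbx] at hrc
      exact h₃ a (mem_erase.2 ⟨hax, ha⟩) b (mem_erase.2 ⟨hbx, hb⟩) c (mem_erase.2 ⟨hcx, hc⟩)
        hab hcb hra hrc hac
  · push Not at h
    refine ⟨fun _ => 0, fun a ha hav => absurd (h a ha) hav, fun a ha b hb _ => ?_, ?_⟩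
    · rw [h a ha, h b hb]
    · intro a ha b hb c hc _ _ h0
      exact absurd h0 (lt_irrefl _)

end SimpleGraph

/-! ### Acyclic moral orientations and their equivalence -/

namespace MixedGraph

variable {V : Type*}

instance [Finite V] : Finite (MixedGraph V) :=
  Finite.of_injective (fun H : MixedGraph V => (H.verts, H.edge)) fun _ _ h =>
    MixedGraph.ext (congrArg Prod.fst h) (congrArg Prod.snd h)

/-- `D` is an acyclic moral orientation of `G[S]`: an acyclic orientation without v-structures. -/
structure IsAMO (G : SimpleGraph V) (S : Finset V) (D : MixedGraph V) : Prop where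
  verts_eq : D.verts = S
  isDAG : D.IsDAG
  edge_or : ∀ {a b}, D.edge a b ∨ D.edge b a ↔ G.Adj a b ∧ a ∈ S ∧ b ∈ S
  adj_of_edge : ∀ {a b c}, D.edge a b → D.edge c b → a ≠ c → G.Adj a c

theorem IsDAG.asymm {D : MixedGraph V} (h : D.IsDAG) {a b : V} (hab : D.edge a b) :
    ¬ D.edge b a := fun hba => h a (.tail (.single hab) hba)

theorem IsDAG.directed_iff {D : MixedGraph V} (h : D.IsDAG) {a b : V} :
    D.Directed a b ↔ D.edge a b := ⟨And.left, fun hab => ⟨hab, h.asymm hab⟩⟩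

namespace IsAMO

variable {G : SimpleGraph V} {S T : Finset V} {D D' : MixedGraph V} {a b : V}

theorem adj (hD : IsAMO G S D) (h : D.edge a b) : G.Adj a b := (hD.edge_or.1 (.inl h)).1

theorem left_mem (hD : IsAMO G S D) (h : D.edge a b) : a ∈ S := (hD.edge_or.1 (.inl h)).2.1

theorem right_mem (hD : IsAMO G S D) (h : D.edge a b) : b ∈ S := (hD.edge_or.1 (.inl h)).2.2

theorem edge_swap_iff (hD : IsAMO G S D) : D.edge b a ↔ (G.Adj a b ∧ a ∈ S ∧ b ∈ S) ∧
    ¬ D.edge a b := by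
  rw [← hD.edge_or]
  exact ⟨fun h => ⟨.inr h, hD.isDAG.asymm h⟩, fun h => h.1.resolve_left h.2⟩

theorem vStructures_eq (hD : IsAMO G S D) : D.vStructures = ∅ := by
  refine Set.eq_empty_of_forall_notMem ?_
  rintro ⟨a, b, c⟩ ⟨hac, hab, hcb, h₁, h₂⟩
  exact (hD.edge_or.2 ⟨hD.adj_of_edge hab.1 hcb.1 hac, hD.left_mem hab.1, hD.left_mem hcb.1⟩).elim
    h₁ h₂

/-- An acyclic orientation of `G[S]` without v-structures is moral. -/
theorem of_vStructures_eq (hv : D.verts = S) (hdag : D.IsDAG)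
    (he : ∀ {a b}, D.edge a b ∨ D.edge b a ↔ G.Adj a b ∧ a ∈ S ∧ b ∈ S)
    (h : D.vStructures = ∅) : IsAMO G S D := by
  refine ⟨hv, hdag, he, fun {a b c} hab hcb hac => ?_⟩
  by_contra hadj
  refine Set.notMem_empty (a, b, c) (h ▸ ⟨hac, hdag.directed_iff.2 hab, hdag.directed_iff.2 hcb,
    fun hac => hadj (he.1 (.inl hac)).1, fun hca => hadj (he.1 (.inr hca)).1⟩)

/-- Two acyclic moral orientations of the same graph are interventionally equivalent for
single-node targets if they agree on the edges at the targets. -/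
theorem iEquiv_iff (hD : IsAMO G S D) (hD' : IsAMO G S D') :
    IEquiv (singleNodes T) D D' ↔ ∀ v ∈ T, ∀ u, D.edge u v ↔ D'.edge u v := by
  have hskel : ∀ I : Set V, (D.intervene I).skeleton = (D'.intervene I).skeleton ↔
      ∀ a b, (D.edge a b ∧ b ∉ I ∨ D.edge b a ∧ a ∉ I) ↔
        (D'.edge a b ∧ b ∉ I ∨ D'.edge b a ∧ a ∉ I) := by
    intro I
    rw [MixedGraph.ext_iff]
    simp only [skeleton, intervene, hD.verts_eq, hD'.verts_eq, true_and, funext_iff, eq_iff_iff]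
  constructor
  · rintro ⟨-, -, h⟩ v hv u
    -- After intervening on `v`, the edge between `u` and `v` survives exactly if it points out of
    -- `v`, so the skeleton reveals its orientation.
    have h₁ := (hskel {v}).1 (h {v} (.inl ⟨v, hv, rfl⟩)) u v
    by_cases huv : u = v
    · subst huv
      exact iff_of_false (fun h => (hD.adj h).ne rfl) fun h => (hD'.adj h).ne rfl
    simp only [Set.mem_singleton_iff, not_true, and_false, huv, not_false_iff, and_true,
      false_or] at h₁
    rw [hD.edge_swap_iff, hD'.edge_swap_iff] at h₁
    have h₂ := hD.edge_or (a := u) (b := v)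
    have h₃ := hD'.edge_or (a := u) (b := v)
    tauto
  · intro h
    refine ⟨hD.verts_eq.trans hD'.verts_eq.symm, hD.vStructures_eq.trans hD'.vStructures_eq.symm,
      ?_⟩
    rintro I (⟨v, hv, rfl⟩ | rfl)
    · refine (hskel _).2 fun a b => ?_
      have h₂ := hD.edge_or (a := a) (b := b)
      have h₃ := hD'.edge_or (a := a) (b := b)
      have h₄ : D.edge a b → ¬ D.edge b a := hD.isDAG.asymm
      have h₅ : D'.edge a b → ¬ D'.edge b a := hD'.isDAG.asymm
      simp only [Set.mem_singleton_iff]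
      by_cases ha : a = v <;> by_cases hb : b = v
      · simp [ha, hb]
      · have := h v hv b
        subst ha
        simp only [hb, not_true, not_false_iff, and_true, and_false, or_false]
        tauto
      · have := h v hv a
        subst hb
        simp only [ha, not_true, not_false_iff, and_true, and_false, false_or]
        tauto
      · simp only [ha, hb, not_false_iff, and_true]
        exact h₂.trans h₃.symm
    · refine (hskel _).2 fun a b => ?_
      simp only [Set.mem_empty_iff_false, not_false_iff, and_true]
      exact hD.edge_or.trans hD'.edge_or.symm

theorem of_iEquiv {𝓘 : Set (Set V)} (hD : IsAMO G S D) (hdag : D'.IsDAG) (h : IEquiv 𝓘 D D') :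
    IsAMO G S D' := by
  obtain ⟨h₁, h₂, h₃⟩ := h
  refine of_vStructures_eq (h₁ ▸ hD.verts_eq) hdag (fun {a b} => ?_) (h₂ ▸ hD.vStructures_eq)
  rw [← hD.edge_or]
  have := congrFun (congrFun (congrArg MixedGraph.edge (h₃ ∅ (.inr rfl))) a) b
  simpa [skeleton, intervene] using this.symm

theorem mem_IMEC_iff (hD : IsAMO G S D) : D' ∈ IMEC (singleNodes T) D ↔
    IsAMO G S D' ∧ ∀ v ∈ T, ∀ u, D.edge u v ↔ D'.edge u v := by
  constructor
  · rintro ⟨hdag, h⟩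
    have := hD.of_iEquiv hdag h
    exact ⟨this, (hD.iEquiv_iff this).1 h⟩
  · rintro ⟨hD', h⟩
    exact ⟨hD'.isDAG, (hD.iEquiv_iff hD').2 h⟩

theorem mem_IMEC_self (hD : IsAMO G S D) : D ∈ IMEC (singleNodes T) D :=
  hD.mem_IMEC_iff.2 ⟨hD, fun _ _ _ => Iff.rfl⟩

theorem IMEC_eq (hD : IsAMO G S D) (h : D' ∈ IMEC (singleNodes T) D) :
    IMEC (singleNodes T) D' = IMEC (singleNodes T) D := by
  obtain ⟨hD', h⟩ := hD.mem_IMEC_iff.1 h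
  ext E
  rw [hD.mem_IMEC_iff, hD'.mem_IMEC_iff]
  exact and_congr_right fun _ => forall₂_congr fun v hv => forall_congr' fun u => by rw [h v hv u]

theorem essentialGraph_eq (hD : IsAMO G S D) (h : D' ∈ IMEC (singleNodes T) D) :
    essentialGraph (singleNodes T) D' = essentialGraph (singleNodes T) D := by
  refine MixedGraph.ext ((hD.mem_IMEC_iff.1 h).1.verts_eq.trans hD.verts_eq.symm) ?_
  simp only [essentialGraph, hD.IMEC_eq h]

/-- All members share one skeleton, so if none contains `b → a`, each contains `a → b`. -/
theorem directed_essentialGraph_iff (hD : IsAMO G S D) :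
    (essentialGraph (singleNodes T) D).Directed a b ↔
      ∀ D' ∈ IMEC (singleNodes T) D, D'.edge a b := by
  constructor
  · rintro ⟨⟨E, hE, hab⟩, h⟩ D' hD'
    have hE' := (hD.mem_IMEC_iff.1 hE).1
    exact (((hD.mem_IMEC_iff.1 hD').1.edge_or).2 (hE'.edge_or.1 (.inl hab))).resolve_right
      fun hba => h ⟨D', hD', hba⟩
  · exact fun h => ⟨⟨D, hD.mem_IMEC_self, h D hD.mem_IMEC_self⟩, fun ⟨E, hE, hba⟩ =>
      hE.1.asymm (h E hE) hba⟩

theorem induce [DecidableEq V] (hD : IsAMO G S D) {C : Finset V} (hC : C ⊆ S) :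
    IsAMO G C (D.induce C) where
  verts_eq := by
    simp only [MixedGraph.induce, hD.verts_eq]
    exact inter_eq_right.2 hC
  isDAG a h := hD.isDAG a (Relation.TransGen.mono (fun _ _ h => h.1) _ _ h)
  edge_or {a b} := by
    have := hD.edge_or (a := a) (b := b)
    have h₁ : a ∈ C → a ∈ S := @hC a
    have h₂ : b ∈ C → b ∈ S := @hC b
    simp only [MixedGraph.induce]
    tauto
  adj_of_edge h h' hne := hD.adj_of_edge h.1 h'.1 hne

end IsAMO

variable {G : SimpleGraph V} {S T : Finset V} {D D' : MixedGraph V} {a b : V}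

/-- Every edge of a chordal graph is oriented from `v` in some acyclic moral orientation. -/
theorem exists_isAMO_source (hG : G.HasChords) (hv : a ∈ S) :
    ∃ D, IsAMO G S D ∧ ∀ b ∈ S, G.Adj a b → D.edge a b := by
  obtain ⟨r, hr₁, hr₂, hr₃⟩ := hG.exists_ordering S hv
  -- Orient each edge towards the higher rank; earlier neighbours of a node form a clique, which
  -- rules out v-structures.
  refine ⟨⟨S, fun a b => G.Adj a b ∧ a ∈ S ∧ b ∈ S ∧ r a < r b, fun h => h.2.1,
    fun h => h.2.2.1⟩, ⟨rfl, fun a h => ?_, fun {a b} => ?_, fun {a b c} h h' hne => ?_⟩, ?_⟩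
  · refine absurd (Relation.TransGen.trans_induction_on (motive := fun {a b} _ => r a < r b) h
      (fun h => h.2.2.2) fun _ _ => lt_trans) (lt_irrefl _)
  · constructor
    · rintro (h | h)
      · exact ⟨h.1, h.2.1, h.2.2.1⟩
      · exact ⟨h.1.symm, h.2.2.1, h.2.1⟩
    · rintro ⟨h, ha, hb⟩
      rcases lt_or_gt_of_ne fun hr => h.ne (hr₂ ha hb hr) with hlt | hlt
      · exact .inl ⟨h, ha, hb, hlt⟩
      · exact .inr ⟨h.symm, hb, ha, hlt⟩
  · exact hr₃ a h.2.1 b h.2.2.1 c h'.2.1 h.1 h'.1 h.2.2.2 h'.2.2.2 hne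
  · exact fun b hb hab => ⟨hab, hv, hb, hr₁ b hb hab.ne'⟩

theorem exists_isAMO (hG : G.HasChords) (S : Finset V) : ∃ D, IsAMO G S D := by
  rcases S.eq_empty_or_nonempty with rfl | ⟨a, ha⟩
  · refine ⟨⟨∅, fun _ _ => False, False.elim, False.elim⟩, rfl, fun a h => ?_, by simp,
      fun h => h.elim⟩
    obtain ⟨_, -, h⟩ := Relation.TransGen.tail'_iff.1 h
    exact h
  · exact (exists_isAMO_source hG ha).imp fun _ => And.left

theorem singleNodes_empty : singleNodes (∅ : Finset V) = ∅ := by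
  ext; simp [singleNodes]

theorem singleNodes_singleton (v : V) : singleNodes {v} = {{v}} := by
  ext; simp [singleNodes]

/-- For a chordal graph, the Markov equivalence class that corresponds to `G[S]` consists of the
acyclic moral orientations. -/
theorem mem_dags_inducedGraph_iff [Fintype V] [DecidableEq V] (hG : G.HasChords) :
    D ∈ (inducedGraph G S).dags ↔ IsAMO G S D := by
  have hverts : (inducedGraph G S).verts = S := by simp [inducedGraph, MixedGraph.induce, ofGraph]
  constructor
  · rintro ⟨hdag, h⟩
    have hedge : ∀ a b, (∃ D' ∈ IMEC ∅ D, D'.edge a b) ↔ G.Adj a b ∧ a ∈ S ∧ b ∈ S := fun a b =>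
      iff_of_eq (congrFun (congrFun (congrArg MixedGraph.edge h) a) b)
    have hself : D ∈ IMEC ∅ D := ⟨hdag, rfl, rfl, fun _ _ => rfl⟩
    have hadj : ∀ {a b}, D.edge a b ∨ D.edge b a ↔ G.Adj a b ∧ a ∈ S ∧ b ∈ S := by
      intro a b
      constructor
      · rintro (h | h)
        · exact (hedge a b).1 ⟨D, hself, h⟩
        · have := (hedge b a).1 ⟨D, hself, h⟩
          exact ⟨this.1.symm, this.2.2, this.2.1⟩
      · intro h
        obtain ⟨D', ⟨-, -, -, h₃⟩, hab⟩ := (hedge a b).2 h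
        have := congrFun (congrFun (congrArg MixedGraph.edge (h₃ ∅ (.inr rfl))) a) b
        simp only [skeleton, intervene, Set.mem_empty_iff_false, not_false_iff, and_true] at this
        rw [this]
        exact .inl hab
    refine .of_vStructures_eq ((congrArg MixedGraph.verts h).trans hverts) hdag hadj ?_
    refine Set.eq_empty_of_forall_notMem ?_
    rintro ⟨a, b, c⟩ ht
    have hab := hadj.1 (.inl ht.2.1.1)
    -- Every edge is reversed in some member of the class, whereas v-structures are common to all
    -- members.
    obtain ⟨D', ⟨-, -, h₂, -⟩, hba⟩ := (hedge b a).2 ⟨hab.1.symm, hab.2.2, hab.2.1⟩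
    exact (h₂ ▸ ht : (a, b, c) ∈ D'.vStructures).2.1.2 hba
  · refine fun hD => ⟨hD.isDAG, MixedGraph.ext (hD.verts_eq.trans hverts.symm) ?_⟩
    funext a b
    refine propext ?_
    change (∃ D' ∈ IMEC ∅ D, D'.edge a b) ↔ G.Adj a b ∧ a ∈ S ∧ b ∈ S
    rw [← singleNodes_empty]
    constructor
    · rintro ⟨D', hD', h⟩
      exact (hD.mem_IMEC_iff.1 hD').1.edge_or.1 (.inl h)
    · rintro ⟨h, ha, hb⟩
      obtain ⟨E, hE, hE'⟩ := exists_isAMO_source hG ha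
      exact ⟨E, hD.mem_IMEC_iff.2 ⟨hE, by simp⟩, hE' b hb h⟩

end MixedGraph

/-! ### Forced orientations -/

namespace MixedGraph

variable {V : Type*}

/-- The orientations that follow from those of `D` on the edges at `T` by the first two Meek
rules. -/
inductive Forced (G : SimpleGraph V) (S T : Finset V) (D : MixedGraph V) : V → V → Prop
  | target {a b} (h : D.edge a b) (hT : a ∈ T ∨ b ∈ T) : Forced G S T D a b
  | unshielded {z a b} (h : Forced G S T D z a) (hab : G.Adj a b) (hb : b ∈ S)
      (hzb : ¬ G.Adj z b) (hne : z ≠ b) : Forced G S T D a b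
  | acyclic {a z b} (h : Forced G S T D a z) (h' : Forced G S T D z b) (hab : G.Adj a b) :
      Forced G S T D a b

section Forced

variable {G : SimpleGraph V} {S T : Finset V} {D D' : MixedGraph V} {a b c : V}

/-- Soundness of the rules: reversing the edge would contradict agreement at the targets, create a
v-structure, or close a directed cycle. -/
theorem Forced.edge (hD : IsAMO G S D) (h : Forced G S T D a b)
    (hD' : D' ∈ IMEC (singleNodes T) D) : D'.edge a b := by
  obtain ⟨hA, hT⟩ := hD.mem_IMEC_iff.1 hD'
  induction h with
  | @target a b h hab =>
    rcases hab with ha | hb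
    · rw [hA.edge_swap_iff, ← hT a ha, ← hD.edge_swap_iff]
      exact h
    · exact (hT b hb a).1 h
  | @unshielded z a b _ hab hb hzb hne ih =>
    exact (hA.edge_or.2 ⟨hab, hA.right_mem ih, hb⟩).resolve_right fun h =>
      hzb (hA.adj_of_edge ih h hne)
  | @acyclic a z b _ _ hab ih ih' =>
    exact (hA.edge_or.2 ⟨hab, hA.left_mem ih, hA.right_mem ih'⟩).resolve_right fun h =>
      hA.isDAG a (.tail (.tail (.single ih) ih') h)

theorem Forced.edge_self (hD : IsAMO G S D) (h : Forced G S T D a b) : D.edge a b :=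
  h.edge hD hD.mem_IMEC_self

/-- Forced parents are shared along edges that are not forced. -/
theorem Forced.of_not_forced (hD : IsAMO G S D) (h : Forced G S T D a b) (hbc : G.Adj b c)
    (hc : c ∈ S) (h₁ : ¬ Forced G S T D b c) (h₂ : ¬ Forced G S T D c b) :
    Forced G S T D a c := by
  -- If `a` and `c` were not adjacent, `a → b` would force `b → c`.
  have adj_left : ∀ {a b}, Forced G S T D a b → G.Adj b c → ¬ Forced G S T D b c →
      ¬ Forced G S T D c b → G.Adj a c := fun h hbc h₁ h₂ => by
    by_contra hac
    exact h₁ (.unshielded h hbc hc hac fun h' => h₂ (h' ▸ h))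
  have hac := adj_left h hbc h₁ h₂
  have at_target : ∀ {a b}, G.Adj a b → a ∈ S → b ∈ S → a ∈ T ∨ b ∈ T →
      Forced G S T D a b ∨ Forced G S T D b a := fun hab ha hb hT =>
    (hD.edge_or.2 ⟨hab, ha, hb⟩).imp (.target · hT) (.target · hT.symm)
  induction h with
  | @target a b h hT =>
    -- If `a` is a target, the edge between `a` and `c` is forced, and `c → a → b` would force `c →
    -- b`. If `b` is a target, the edge between `b` and `c` is itself forced.
    rcases hT with ha | hb
    · exact (at_target hac (hD.left_mem h) hc (.inl ha)).resolve_right fun hca =>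
        h₂ (.acyclic hca (.target h (.inl ha)) hbc.symm)
    · exact ((at_target hbc (hD.right_mem h) hc (.inl hb)).elim h₁ h₂).elim
  | @unshielded z a b hza hab hb hzb hne ih =>
    have hf : Forced G S T D a b := .unshielded hza hab hb hzb hne
    -- If `a → c` is not forced, neither is `c → a`, so induction on `z → a` makes `z → c` forced.
    -- As `z` and `b` are not adjacent, this forces `c → b`.
    by_contra hnac
    have hnca : ¬ Forced G S T D c a := fun hca => h₂ (.acyclic hca hf hbc.symm)
    exact h₂ (.unshielded (ih hac hnac hnca (adj_left hza hac hnac hnca)) hbc.symm hb hzb hne)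
  | @acyclic a z b haz hzb hab ih ih' =>
    exact .acyclic haz (ih' hbc h₁ h₂ (adj_left hzb hbc h₁ h₂)) hac

end Forced

/-! ### Chain graphs and gluing of orientations -/

/-- `R` is a chain graph with skeleton `G[S]` whose directed edges are edges of `D`. -/
structure IsChainGraph (G : SimpleGraph V) (S : Finset V) (D R : MixedGraph V) : Prop where
  verts_eq : R.verts = S
  edge_or : ∀ {a b}, R.edge a b ∨ R.edge b a ↔ G.Adj a b ∧ a ∈ S ∧ b ∈ S
  edge_of_directed : ∀ {a b}, R.Directed a b → D.edge a b
  directed_of_undirected : ∀ {a b c}, R.Directed a b → R.Undirected b c → R.Directed a c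

theorem Undirected.symm {R : MixedGraph V} {a b : V} (h : R.Undirected a b) : R.Undirected b a :=
  ⟨h.2, h.1⟩

/-- `a` and `b` are in the same chain component. -/
def Linked (R : MixedGraph V) : V → V → Prop := Relation.ReflTransGen R.Undirected

theorem Linked.symm {R : MixedGraph V} {a b : V} (h : R.Linked a b) : R.Linked b a := by
  induction h with
  | refl => exact .refl
  | tail _ h ih => exact .head h.symm ih

theorem mem_chainComponents [DecidableEq V] {R : MixedGraph V} {C : Finset V} :
    C ∈ R.chainComponents ↔ ∃ a ∈ R.verts, ∀ b, b ∈ C ↔ R.Linked a b := by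
  classical
  simp only [chainComponents, mem_image, Finset.ext_iff, mem_filter]
  refine exists_congr fun a => and_congr_right fun ha => forall_congr' fun b => ?_
  have : R.Linked a b → b ∈ R.verts := fun h => by
    rcases Relation.ReflTransGen.cases_tail h with rfl | ⟨c, -, h⟩
    · exact ha
    · exact R.right_mem h.1
  rw [iff_comm (a := b ∈ C)]
  exact ⟨fun h => ⟨fun h' => h.1 ⟨this h', h'⟩, fun h' => (h.2 h').2⟩,
    fun h => ⟨fun h' => h.1 h'.2, fun h' => ⟨this (h.2 h'), h.2 h'⟩⟩⟩

theorem exists_chainComponent [DecidableEq V] {R : MixedGraph V} {a : V} (ha : a ∈ R.verts) :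
    ∃ C ∈ R.chainComponents, a ∈ C := by
  classical
  refine ⟨_, mem_image_of_mem _ ha, ?_⟩
  simpa using ⟨ha, Relation.ReflTransGen.refl⟩

section Components

variable [DecidableEq V] {R : MixedGraph V} {C C' : Finset V} {a b : V}

theorem subset_of_mem_chainComponents (hC : C ∈ R.chainComponents) : C ⊆ R.verts := by
  classical
  obtain ⟨a, -, rfl⟩ := mem_image.1 hC
  exact filter_subset _ _

theorem mem_component_iff (hC : C ∈ R.chainComponents) (ha : a ∈ C) : b ∈ C ↔ R.Linked a b := by
  obtain ⟨c, -, h⟩ := mem_chainComponents.1 hC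
  have hca := (h a).1 ha
  rw [h b]
  exact ⟨fun h => hca.symm.trans h, fun h => hca.trans h⟩

theorem component_unique (hC : C ∈ R.chainComponents) (hC' : C' ∈ R.chainComponents) (ha : a ∈ C)
    (ha' : a ∈ C') : C = C' := by
  ext b
  rw [mem_component_iff hC ha, mem_component_iff hC' ha']

theorem Undirected.exists_component (h : R.Undirected a b) :
    ∃ C ∈ R.chainComponents, a ∈ C ∧ b ∈ C := by
  obtain ⟨C, hC, ha⟩ := exists_chainComponent (R.left_mem h.1)
  exact ⟨C, hC, ha, (mem_component_iff hC ha).2 (.single h)⟩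

end Components

/-- Directs the chain components of `R` according to the graphs `E C`. -/
def glue [DecidableEq V] (R : MixedGraph V) (E : Finset V → MixedGraph V) : MixedGraph V where
  verts := R.verts
  edge a b := R.Directed a b ∨ ∃ C ∈ R.chainComponents, a ∈ C ∧ b ∈ C ∧ (E C).edge a b
  left_mem h := h.elim (fun h => R.left_mem h.1) fun ⟨_, hC, ha, _⟩ =>
    subset_of_mem_chainComponents hC ha
  right_mem h := h.elim (fun h => R.right_mem h.1) fun ⟨_, hC, _, hb, _⟩ =>
    subset_of_mem_chainComponents hC hb

namespace IsChainGraph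

variable {G : SimpleGraph V} {S T : Finset V} {D R : MixedGraph V} {a b c : V}

theorem directed_of_linked (hR : IsChainGraph G S D R) (h : R.Directed a b) (hbc : R.Linked b c) :
    R.Directed a c := by
  induction hbc with
  | refl => exact h
  | tail _ h' ih => exact hR.directed_of_undirected ih h'

theorem not_linked (hR : IsChainGraph G S D R) (h : R.Directed a b) : ¬ R.Linked a b := fun h' =>
  have := hR.directed_of_linked h h'.symm
  this.2 this.1

theorem cases (hR : IsChainGraph G S D R) (hab : G.Adj a b) (ha : a ∈ S) (hb : b ∈ S) :
    R.Directed a b ∨ R.Directed b a ∨ R.Undirected a b := by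
  have := hR.edge_or.2 ⟨hab, ha, hb⟩
  unfold Directed Undirected
  tauto

variable [DecidableEq V] {E : Finset V → MixedGraph V} {C : Finset V}

theorem subset (hR : IsChainGraph G S D R) (hC : C ∈ R.chainComponents) : C ⊆ S :=
  hR.verts_eq ▸ subset_of_mem_chainComponents hC

theorem glue_edge_iff (hR : IsChainGraph G S D R) (hC : C ∈ R.chainComponents) (ha : a ∈ C)
    (hb : b ∈ C) : (R.glue E).edge a b ↔ (E C).edge a b := by
  constructor
  · rintro (h | ⟨C', hC', ha', hb', h⟩)
    · exact absurd ((mem_component_iff hC ha).1 hb) (hR.not_linked h)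
    · rwa [component_unique hC hC' ha ha']
  · exact fun h => .inr ⟨C, hC, ha, hb, h⟩

theorem induce_glue (hR : IsChainGraph G S D R) (hC : C ∈ R.chainComponents)
    (hE : IsAMO G C (E C)) : (R.glue E).induce C = E C := by
  refine MixedGraph.ext ?_ ?_
  · rw [hE.verts_eq]
    exact inter_eq_right.2 (subset_of_mem_chainComponents (R := R) hC)
  · funext a b
    refine propext ⟨fun ⟨h, ha, hb⟩ => (hR.glue_edge_iff hC ha hb).1 h, fun h => ?_⟩
    exact ⟨(hR.glue_edge_iff hC (hE.left_mem h) (hE.right_mem h)).2 h, hE.left_mem h,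
      hE.right_mem h⟩

/-- A directed edge into a component reaches all of its nodes, so later steps inside the component
can be absorbed into it. A closed walk thus yields a cycle in one component or a cycle of directed
edges of `R`, which lies in `D`. -/
theorem glue_isDAG (hR : IsChainGraph G S D R) (hD : D.IsDAG)
    (hE : ∀ C ∈ R.chainComponents, (E C).IsDAG) : (R.glue E).IsDAG := by
  intro a h
  -- `a'` absorbs the steps inside the component of `a` before the first directed edge.
  have key : ∀ b, Relation.TransGen (R.glue E).edge a b →
      (∃ C ∈ R.chainComponents, a ∈ C ∧ b ∈ C ∧ Relation.TransGen (E C).edge a b) ∨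
      ∃ a', R.Linked a a' ∧ Relation.TransGen R.Directed a' b := by
    intro b h
    induction h with
    | single h =>
      rcases h with h | ⟨C, hC, ha, hb, h⟩
      · exact .inr ⟨a, .refl, .single h⟩
      · exact .inl ⟨C, hC, ha, hb, .single h⟩
    | tail _ h ih =>
      rcases h with h | ⟨C, hC, hb, hc, h⟩
      · rcases ih with ⟨C', hC', ha, hb, -⟩ | ⟨a', haa, h'⟩
        · exact .inr ⟨_, (mem_component_iff hC' ha).1 hb, .single h⟩
        · exact .inr ⟨a', haa, h'.tail h⟩
      · rcases ih with ⟨C', hC', ha, hb', h'⟩ | ⟨a', haa, h'⟩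
        · obtain rfl := component_unique hC hC' hb hb'
          exact .inl ⟨C, hC, ha, hc, h'.tail h⟩
        · obtain ⟨d, hd, hdb⟩ := Relation.TransGen.tail'_iff.1 h'
          exact .inr ⟨a', haa, .tail' hd
            (hR.directed_of_linked hdb ((mem_component_iff hC hb).1 hc))⟩
  rcases key a h with ⟨C, hC, -, -, h⟩ | ⟨a', haa, h⟩
  · exact hE C hC a h
  · obtain ⟨d, hd, hda⟩ := Relation.TransGen.tail'_iff.1 h
    have : Relation.TransGen R.Directed a' a' := .tail' hd (hR.directed_of_linked hda haa)
    exact hD a' (Relation.TransGen.mono (fun _ _ => hR.edge_of_directed) _ _ this)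

/-- Acyclic moral orientations of the chain components glue together. -/
theorem glue_isAMO (hR : IsChainGraph G S D R) (hD : IsAMO G S D)
    (hE : ∀ C ∈ R.chainComponents, IsAMO G C (E C)) : IsAMO G S (R.glue E) where
  verts_eq := hR.verts_eq
  isDAG := hR.glue_isDAG hD.isDAG fun C hC => (hE C hC).isDAG
  edge_or {a b} := by
    constructor
    · have : ∀ {a b}, (R.glue E).edge a b → G.Adj a b ∧ a ∈ S ∧ b ∈ S := by
        rintro a b (h | ⟨C, hC, ha, hb, h⟩)
        · exact hR.edge_or.1 (.inl h.1)
        · exact ⟨(hE C hC).adj h, hR.subset hC ha, hR.subset hC hb⟩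
      rintro (h | h)
      · exact this h
      · exact ⟨(this h).1.symm, (this h).2.2, (this h).2.1⟩
    · rintro ⟨hab, ha, hb⟩
      rcases hR.cases hab ha hb with h | h | h
      · exact .inl (.inl h)
      · exact .inr (.inl h)
      · obtain ⟨C, hC, ha, hb⟩ := h.exists_component
        rw [hR.glue_edge_iff hC ha hb, hR.glue_edge_iff hC hb ha]
        exact (hE C hC).edge_or.2 ⟨hab, ha, hb⟩
  adj_of_edge {a b c} hab hcb hac := by
    -- Two directed parents are adjacent since `D` is moral. If only one is directed, it is a parent
    -- of the whole component of `b`, hence of the other one.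
    rcases hab with h | ⟨C, hC, ha, hb, h⟩ <;> rcases hcb with h' | ⟨C', hC', hc, hb', h'⟩
    · exact hD.adj_of_edge (hR.edge_of_directed h) (hR.edge_of_directed h') hac
    · exact (hR.edge_or.1 (.inl
        (hR.directed_of_linked h ((mem_component_iff hC' hb').1 hc)).1)).1
    · exact (hR.edge_or.1 (.inl
        (hR.directed_of_linked h' ((mem_component_iff hC hb).1 ha)).1)).1.symm
    · obtain rfl := component_unique hC hC' hb hb'
      exact (hE C hC).adj_of_edge h h' hac

end IsChainGraph

/-! ### The essential graph is the chain graph of forced edges -/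

section EssentialGraph

variable {G : SimpleGraph V} {S T : Finset V} {D : MixedGraph V}

/-- `G[S]` with the forced edges directed. -/
def forcedGraph (G : SimpleGraph V) (S T : Finset V) (D : MixedGraph V) : MixedGraph V where
  verts := S
  edge a b := (G.Adj a b ∧ a ∈ S ∧ b ∈ S) ∧ ¬ Forced G S T D b a
  left_mem h := h.1.2.1
  right_mem h := h.1.2.2

theorem directed_forcedGraph_iff (hD : IsAMO G S D) {a b : V} :
    (forcedGraph G S T D).Directed a b ↔ Forced G S T D a b := by
  constructor
  · rintro ⟨⟨⟨hab, ha, hb⟩, -⟩, h⟩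
    by_contra hf
    exact h ⟨⟨hab.symm, hb, ha⟩, hf⟩
  · intro h
    have he := h.edge_self hD
    exact ⟨⟨⟨hD.adj he, hD.left_mem he, hD.right_mem he⟩, fun h' =>
      hD.isDAG.asymm he (h'.edge_self hD)⟩, fun h' => h'.2 h⟩

theorem isChainGraph_forcedGraph (hD : IsAMO G S D) :
    IsChainGraph G S D (forcedGraph G S T D) where
  verts_eq := rfl
  edge_or {a b} := by
    constructor
    · rintro (h | h)
      · exact h.1
      · exact ⟨h.1.1.symm, h.1.2.2, h.1.2.1⟩
    · rintro ⟨hab, ha, hb⟩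
      by_contra! h
      have h₁ := not_not.1 fun hf => h.1 ⟨⟨hab, ha, hb⟩, hf⟩
      have h₂ := not_not.1 fun hf => h.2 ⟨⟨hab.symm, hb, ha⟩, hf⟩
      exact hD.isDAG.asymm (h₁.edge_self hD) (h₂.edge_self hD)
  edge_of_directed h := ((directed_forcedGraph_iff hD).1 h).edge_self hD
  directed_of_undirected h h' := by
    rw [directed_forcedGraph_iff hD] at h ⊢
    exact h.of_not_forced hD h'.1.1.1 h'.1.1.2.2 h'.2.2 h'.1.2

/-- All edges of `D` at targets are directed in `R`, so gluing leaves them unchanged. `R` is kept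
general because the lemma serves for `forcedGraph` before that is known to be the essential graph.
-/
theorem glue_mem_IMEC_of_forced [DecidableEq V] (hD : IsAMO G S D) {R : MixedGraph V}
    (hR : IsChainGraph G S D R) (hT : ∀ {a b}, D.edge a b → b ∈ T → R.Directed a b)
    (hT' : ∀ {a b}, D.edge a b → a ∈ T → R.Directed a b) {E : Finset V → MixedGraph V}
    (hE : ∀ C ∈ R.chainComponents, IsAMO G C (E C)) :
    R.glue E ∈ IMEC (singleNodes T) D := by
  have hg := hR.glue_isAMO hD hE
  refine hD.mem_IMEC_iff.2 ⟨hg, fun v hv u => ⟨fun h => .inl (hT h hv), fun h => ?_⟩⟩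
  refine (hD.edge_or.2 (hg.edge_or.1 (.inl h))).resolve_right fun h' => ?_
  exact hg.isDAG.asymm h (.inl (hT' h' hv))

/-- For a chordal graph, exactly the forced edges of the essential graph are directed. -/
theorem essentialGraph_eq_forcedGraph (hG : G.HasChords) (hD : IsAMO G S D) :
    essentialGraph (singleNodes T) D = forcedGraph G S T D := by
  classical
  refine MixedGraph.ext hD.verts_eq ?_
  funext a b
  refine propext ⟨?_, fun h => ?_⟩
  · rintro ⟨D', hD', hab⟩
    have hA := (hD.mem_IMEC_iff.1 hD').1
    exact ⟨hA.edge_or.1 (.inl hab), fun h => hA.isDAG.asymm hab (h.edge hD hD')⟩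
  · have hR := isChainGraph_forcedGraph (T := T) hD
    by_cases hba : (forcedGraph G S T D).edge b a
    · obtain ⟨C, hC, ha, hb⟩ := Undirected.exists_component ⟨h, hba⟩
      -- An unforced edge lies inside a component; making `a` a source of that component yields a
      -- member with `a → b`.
      obtain ⟨E₀, hE₀, hab⟩ := exists_isAMO_source hG ha
      set E : Finset V → MixedGraph V := fun C' => if C' = C then E₀ else D.induce C' with hE
      refine ⟨(forcedGraph G S T D).glue E, glue_mem_IMEC_of_forced hD hR
        (fun h h' => (directed_forcedGraph_iff hD).2 (.target h (.inr h')))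
        (fun h h' => (directed_forcedGraph_iff hD).2 (.target h (.inl h'))) ?_, ?_⟩
      · intro C' hC'
        by_cases hCC : C' = C
        · subst hCC
          simpa [hE] using hE₀
        · simpa [hE, hCC] using hD.induce (hR.subset hC')
      · rw [hR.glue_edge_iff hC ha hb]
        simpa [hE] using hab b hb h.1.1
    · exact ⟨D, hD.mem_IMEC_self, hR.edge_of_directed ⟨h, hba⟩⟩

theorem isChainGraph_essentialGraph (hG : G.HasChords) (hD : IsAMO G S D) :
    IsChainGraph G S D (essentialGraph (singleNodes T) D) :=
  essentialGraph_eq_forcedGraph hG hD ▸ isChainGraph_forcedGraph hD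

/-- Gluing acyclic moral orientations of the chain components of the essential graph stays within
the equivalence class. -/
theorem glue_mem_IMEC [DecidableEq V] (hG : G.HasChords) (hD : IsAMO G S D)
    {E : Finset V → MixedGraph V}
    (hE : ∀ C ∈ (essentialGraph (singleNodes T) D).chainComponents, IsAMO G C (E C)) :
    (essentialGraph (singleNodes T) D).glue E ∈ IMEC (singleNodes T) D := by
  refine glue_mem_IMEC_of_forced hD (isChainGraph_essentialGraph hG hD) ?_ ?_ hE <;>
  · intro a b h h'
    rw [essentialGraph_eq_forcedGraph hG hD, directed_forcedGraph_iff hD]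
    exact .target h (by tauto)

end EssentialGraph

end MixedGraph

/-! ### Decomposition over chain components -/

namespace MixedGraph

theorem mem_Dir {V : Type*} {H : MixedGraph V} {a b : V} : (a, b) ∈ H.Dir ↔ H.Directed a b :=
  Iff.rfl

theorem IMEC_singleNodes_anti {V : Type*} {G : SimpleGraph V} {S T U : Finset V}
    {D D' : MixedGraph V} (hD : IsAMO G S D) (hUT : U ⊆ T)
    (h : D' ∈ IMEC (singleNodes T) D) : D' ∈ IMEC (singleNodes U) D :=
  hD.mem_IMEC_iff.2 <| (hD.mem_IMEC_iff.1 h).imp_right fun h v hv => h v (hUT hv)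

section Decomposition

variable {V : Type*} [DecidableEq V] {G : SimpleGraph V} {S T U : Finset V}
  {D D' : MixedGraph V}

/-- Directed edges of the essential graph occur in every member, and all other edges lie inside
components, so a member is determined by its restrictions. -/
theorem glue_induce (hG : G.HasChords) (hD : IsAMO G S D) (h : D' ∈ IMEC (singleNodes U) D) :
    (essentialGraph (singleNodes U) D).glue D'.induce = D' := by
  have hR := isChainGraph_essentialGraph (T := U) hG hD
  have hA := (hD.mem_IMEC_iff.1 h).1
  refine MixedGraph.ext (hD.verts_eq.trans hA.verts_eq.symm) ?_
  funext a b
  refine propext ⟨?_, fun hab => ?_⟩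
  · rintro (hab | ⟨C, -, -, -, hab⟩)
    · exact hD.directed_essentialGraph_iff.1 hab D' h
    · exact hab.1
  · rcases hR.cases (hA.adj hab) (hA.left_mem hab) (hA.right_mem hab) with h' | h' | h'
    · exact .inl h'
    · exact absurd hab (hA.isDAG.asymm (hD.directed_essentialGraph_iff.1 h' D' h))
    · obtain ⟨C, hC, ha, hb⟩ := h'.exists_component
      exact .inr ⟨C, hC, ha, hb, hab, ha, hb⟩

theorem induce_mem_IMEC (hD : IsAMO G S D) {C : Finset V} (hC : C ⊆ S)
    (h : D' ∈ IMEC (singleNodes T) D) :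
    D'.induce C ∈ IMEC (singleNodes (T ∩ C)) (D.induce C) := by
  obtain ⟨hA, h⟩ := hD.mem_IMEC_iff.1 h
  refine (hD.induce hC).mem_IMEC_iff.2 ⟨hA.induce hC, fun v hv u => ?_⟩
  exact and_congr_left fun _ => h v (mem_inter.1 hv).1 u

/-- The members of a finer equivalence class are obtained by gluing members of the equivalence
classes of the chain components. -/
theorem glue_mem_IMEC_of_induce (hG : G.HasChords) (hD : IsAMO G S D)
    {E : Finset V → MixedGraph V}
    (hE : ∀ C ∈ (essentialGraph (singleNodes U) D).chainComponents,
      E C ∈ IMEC (singleNodes (T ∩ C)) (D.induce C)) :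
    (essentialGraph (singleNodes U) D).glue E ∈ IMEC (singleNodes T) D := by
  have hR := isChainGraph_essentialGraph (T := U) hG hD
  have hDC : ∀ C ∈ (essentialGraph (singleNodes U) D).chainComponents,
      IsAMO G C (D.induce C) := fun C hC => hD.induce (hR.subset hC)
  have hEC : ∀ C ∈ (essentialGraph (singleNodes U) D).chainComponents, IsAMO G C (E C) :=
    fun C hC => ((hDC C hC).mem_IMEC_iff.1 (hE C hC)).1
  have hg := glue_mem_IMEC hG hD hEC
  have hA := (hD.mem_IMEC_iff.1 hg).1
  refine hD.mem_IMEC_iff.2 ⟨hA, fun v hv u => ?_⟩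
  -- An edge at a target is either directed in the essential graph, hence taken from `D`, or inside
  -- a component `C`, where `E C` agrees with `D` at `T ∩ C`.
  by_cases huv : G.Adj u v ∧ u ∈ S ∧ v ∈ S
  · rcases hR.cases huv.1 huv.2.1 huv.2.2 with h | h | h
    · exact iff_of_true (hR.edge_of_directed h) (.inl h)
    · exact iff_of_false (hD.isDAG.asymm (hR.edge_of_directed h)) (hA.isDAG.asymm (.inl h))
    · obtain ⟨C, hC, hu, hv'⟩ := h.exists_component
      rw [hR.glue_edge_iff hC hu hv',
        ← ((hDC C hC).mem_IMEC_iff.1 (hE C hC)).2 v (mem_inter.2 ⟨hv, hv'⟩) u]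
      exact ⟨fun h => ⟨h, hu, hv'⟩, And.left⟩
  · exact iff_of_false (fun h => huv (hD.edge_or.1 (.inl h)))
      fun h => huv (hA.edge_or.1 (.inl h))

/-- The size of an equivalence class is the product of the sizes over the chain components. -/
theorem ncard_IMEC (hG : G.HasChords) (hD : IsAMO G S D) (hUT : U ⊆ T) :
    (IMEC (singleNodes T) D).ncard =
      ∏ C ∈ (essentialGraph (singleNodes U) D).chainComponents,
        (IMEC (singleNodes (T ∩ C)) (D.induce C)).ncard := by
  have hR := isChainGraph_essentialGraph (T := U) hG hD
  set R := essentialGraph (singleNodes U) D with hRdef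
  let f : IMEC (singleNodes T) D →
      ∀ C : R.chainComponents, IMEC (singleNodes (T ∩ (C : Finset V))) (D.induce C) :=
    fun D' C => ⟨D'.1.induce C, induce_mem_IMEC hD (hR.subset C.2) D'.2⟩
  have hf : Function.Bijective f := by
    constructor
    · rintro ⟨D₁, h₁⟩ ⟨D₂, h₂⟩ h
      refine Subtype.ext ?_
      change D₁ = D₂
      rw [← glue_induce hG hD (IMEC_singleNodes_anti hD hUT h₁),
        ← glue_induce hG hD (IMEC_singleNodes_anti hD hUT h₂), ← hRdef]
      refine MixedGraph.ext rfl ?_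
      funext a b
      refine propext (or_congr_right (exists_congr fun C => and_congr_right fun hC => ?_))
      rw [show D₁.induce C = D₂.induce C from congrArg Subtype.val (congrFun h ⟨C, hC⟩)]
    · intro E
      -- The value `D` off the chain components is a dummy that gluing never reads.
      let E' : Finset V → MixedGraph V := fun C =>
        if h : C ∈ R.chainComponents then (E ⟨C, h⟩).1 else D
      have hE' : ∀ C (hC : C ∈ R.chainComponents), E' C = (E ⟨C, hC⟩).1 := fun C hC =>
        dif_pos hC
      refine ⟨⟨R.glue E', glue_mem_IMEC_of_induce hG hD fun C hC => ?_⟩, ?_⟩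
      · rw [hE' C hC]
        exact (E ⟨C, hC⟩).2
      · funext ⟨C, hC⟩
        refine Subtype.ext ?_
        change (R.glue E').induce C = _
        rw [← hE' C hC]
        refine hR.induce_glue hC (((hD.induce (hR.subset hC)).mem_IMEC_iff (T := T ∩ C)).1 ?_).1
        rw [hE' C hC]
        exact (E ⟨C, hC⟩).2
  rw [← Nat.card_coe_set_eq, Nat.card_congr (Equiv.ofBijective f hf), Nat.card_pi]
  exact prod_coe_sort R.chainComponents
    fun C => (IMEC (singleNodes (T ∩ C)) (D.induce C)).ncard

/-- The directed edges of a finer essential graph are those of the coarser one and those within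
its chain components. -/
theorem directed_essentialGraph_iff_of_subset (hG : G.HasChords) (hD : IsAMO G S D) (hUT : U ⊆ T)
    {a b : V} : (essentialGraph (singleNodes T) D).Directed a b ↔
      (essentialGraph (singleNodes U) D).Directed a b ∨
      ∃ C ∈ (essentialGraph (singleNodes U) D).chainComponents,
        (essentialGraph (singleNodes (T ∩ C)) (D.induce C)).Directed a b := by
  have hR := isChainGraph_essentialGraph (T := U) hG hD
  constructor
  · intro h
    rw [hD.directed_essentialGraph_iff] at h
    have hab := h D hD.mem_IMEC_self
    rcases hR.cases (hD.adj hab) (hD.left_mem hab) (hD.right_mem hab) with h' | h' | h'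
    · exact .inl h'
    · exact absurd (hR.edge_of_directed h') (hD.isDAG.asymm hab)
    · obtain ⟨C, hC, ha, hb⟩ := h'.exists_component
      refine .inr ⟨C, hC, (hD.induce (hR.subset hC)).directed_essentialGraph_iff.2 fun E hE => ?_⟩
      -- Extend `E` by `D` on the other components to test the edge in a member of the full class.
      have := h _ (glue_mem_IMEC_of_induce (U := U) hG hD (E := fun C' => if C' = C then E else
        D.induce C') fun C' hC' => ?_)
      · simpa using (hR.glue_edge_iff hC ha hb).1 this
      · by_cases hCC : C' = C
        · subst hCC
          simpa using hE
        · simpa [hCC] using (hD.induce (hR.subset hC')).mem_IMEC_self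
  · rintro (h | ⟨C, hC, h⟩)
    · rw [hD.directed_essentialGraph_iff] at h ⊢
      exact fun D' hD' => h D' (IMEC_singleNodes_anti hD hUT hD')
    · rw [(hD.induce (hR.subset hC)).directed_essentialGraph_iff] at h
      exact hD.directed_essentialGraph_iff.2 fun D' hD' =>
        (h _ (induce_mem_IMEC hD (hR.subset hC) hD')).1

/-- The number of directed edges of an essential graph is additive over the chain components of a
coarser one. -/
theorem ncard_Dir [Finite V] (hG : G.HasChords) (hD : IsAMO G S D) (hUT : U ⊆ T) :
    (essentialGraph (singleNodes T) D).Dir.ncard =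
      (essentialGraph (singleNodes U) D).Dir.ncard +
      ∑ C ∈ (essentialGraph (singleNodes U) D).chainComponents,
        (essentialGraph (singleNodes (T ∩ C)) (D.induce C)).Dir.ncard := by
  classical
  cases nonempty_fintype V
  have hR := isChainGraph_essentialGraph (T := U) hG hD
  set R := essentialGraph (singleNodes U) D
  have hmem : ∀ C ∈ R.chainComponents, ∀ {a b},
      (essentialGraph (singleNodes (T ∩ C)) (D.induce C)).Directed a b → a ∈ C ∧ b ∈ C := by
    intro C hC a b h
    have := hD.induce (hR.subset hC)
    rw [this.directed_essentialGraph_iff] at h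
    exact ⟨this.left_mem (h _ this.mem_IMEC_self), this.right_mem (h _ this.mem_IMEC_self)⟩
  have hunion : (essentialGraph (singleNodes T) D).Dir.toFinset = R.Dir.toFinset ∪
      R.chainComponents.biUnion fun C =>
        (essentialGraph (singleNodes (T ∩ C)) (D.induce C)).Dir.toFinset := by
    ext ⟨a, b⟩
    simp only [Set.mem_toFinset, mem_Dir, mem_union, mem_biUnion]
    exact directed_essentialGraph_iff_of_subset hG hD hUT
  simp only [Set.ncard_eq_toFinset_card']
  rw [hunion, card_union_of_disjoint, card_biUnion]
  · intro C hC C' hC' hne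
    refine disjoint_left.2 fun ⟨a, b⟩ h h' => hne ?_
    simp only [Set.mem_toFinset, mem_Dir] at h h'
    exact component_unique hC hC' (hmem C hC h).1 (hmem C' hC' h').1
  · refine disjoint_left.2 fun ⟨a, b⟩ h h' => ?_
    simp only [Set.mem_toFinset, mem_Dir, mem_biUnion] at h h'
    obtain ⟨C, hC, h'⟩ := h'
    exact hR.not_linked h ((mem_component_iff hC (hmem C hC h').1).1 (hmem C hC h').2)

/-- Acyclic moral orientations of the chain components of the essential graph extend to one of the whole
graph with the same essential graph. -/
theorem exists_isAMO_induce_eq (hG : G.HasChords) (hD : IsAMO G S D)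
    {E : Finset V → MixedGraph V}
    (hE : ∀ C ∈ (essentialGraph (singleNodes U) D).chainComponents, IsAMO G C (E C)) :
    ∃ D', IsAMO G S D' ∧ essentialGraph (singleNodes U) D' = essentialGraph (singleNodes U) D ∧
      ∀ C ∈ (essentialGraph (singleNodes U) D).chainComponents, D'.induce C = E C := by
  have h := glue_mem_IMEC hG hD hE
  exact ⟨_, (hD.mem_IMEC_iff.1 h).1, hD.essentialGraph_eq h, fun C hC =>
    (isChainGraph_essentialGraph hG hD).induce_glue hC (hE C hC)⟩

end Decomposition

/-! ### The recursions and extension to the whole graph -/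

section Recursion

variable {V : Type*} [Fintype V] [DecidableEq V] {G : SimpleGraph V} {S T U : Finset V}
  {D R : MixedGraph V}

theorem mem_resultSpace_iff (hG : G.HasChords) :
    R ∈ resultSpace (singleNodes U) (inducedGraph G S) ↔
      ∃ D, IsAMO G S D ∧ essentialGraph (singleNodes U) D = R := by
  simp only [resultSpace, Set.mem_image, mem_dags_inducedGraph_iff hG]

theorem dpDir_le (hG : G.HasChords) (hD : IsAMO G S D) :
    dpDir G S T ≤ (essentialGraph (singleNodes T) D).Dir.ncard :=
  Nat.sInf_le (Set.mem_image_of_mem _ ((mem_dags_inducedGraph_iff hG).2 hD))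

/-- An acyclic moral orientation exists, so the infimum is attained and is not the default value of
`sInf ∅`. -/
theorem exists_eq_dpDir (hG : G.HasChords) (S T : Finset V) :
    ∃ D, IsAMO G S D ∧ (essentialGraph (singleNodes T) D).Dir.ncard = dpDir G S T := by
  obtain ⟨D, hD⟩ := exists_isAMO hG S
  obtain ⟨E, hE, h⟩ := Nat.sInf_mem (Set.Nonempty.image
    (fun D => (essentialGraph (singleNodes T) D).Dir.ncard)
    ⟨D, (mem_dags_inducedGraph_iff hG).2 hD⟩)
  exact ⟨E, (mem_dags_inducedGraph_iff hG).1 hE, h⟩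

theorem le_dpMEC (hG : G.HasChords) (hD : IsAMO G S D) :
    (IMEC (singleNodes T) D).ncard ≤ dpMEC G S T :=
  le_csSup (Set.toFinite _).bddAbove
    (Set.mem_image_of_mem _ ((mem_dags_inducedGraph_iff hG).2 hD))

theorem exists_eq_dpMEC (hG : G.HasChords) (S T : Finset V) :
    ∃ D, IsAMO G S D ∧ (IMEC (singleNodes T) D).ncard = dpMEC G S T := by
  obtain ⟨D, hD⟩ := exists_isAMO hG S
  obtain ⟨E, hE, h⟩ := Nat.sSup_mem (Set.Nonempty.image
    (fun D => (IMEC (singleNodes T) D).ncard)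
    ⟨D, (mem_dags_inducedGraph_iff hG).2 hD⟩) (Set.toFinite _).bddAbove
  exact ⟨E, (mem_dags_inducedGraph_iff hG).1 hE, h⟩

/-- The least number of directed edges satisfies the recursion over the chain components. -/
theorem isLeast_dpDir (hG : G.HasChords) (hUT : U ⊆ T) :
    IsLeast
      ((fun R : MixedGraph V => R.Dir.ncard + ∑ C ∈ R.chainComponents, dpDir G C (T ∩ C)) ''
        resultSpace (singleNodes U) (inducedGraph G S))
      (dpDir G S T) := by
  have hlower : ∀ R ∈ resultSpace (singleNodes U) (inducedGraph G S),
      dpDir G S T ≤ R.Dir.ncard + ∑ C ∈ R.chainComponents, dpDir G C (T ∩ C) := by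
    intro R hR
    obtain ⟨D, hD, rfl⟩ := (mem_resultSpace_iff hG).1 hR
    -- Optimal orientations of the components are glued into one orientation with the same `R`,
    -- which attains the sum.
    choose E hE hE' using fun C => exists_eq_dpDir hG C (T ∩ C)
    obtain ⟨D', hD', hess, hind⟩ := exists_isAMO_induce_eq (U := U) hG hD fun C _ => hE C
    refine (dpDir_le hG hD').trans (le_of_eq ?_)
    rw [ncard_Dir hG hD' hUT, hess]
    exact congrArg _ (sum_congr rfl fun C hC => by rw [hind C hC, hE'])
  refine ⟨?_, Set.forall_mem_image.2 hlower⟩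
  -- Conversely, a global optimum restricts to a candidate on each component of its own essential
  -- graph.
  obtain ⟨D, hD, h⟩ := exists_eq_dpDir hG S T
  have hR := (mem_resultSpace_iff (U := U) hG).2 ⟨D, hD, rfl⟩
  refine ⟨_, hR, le_antisymm ?_ (hlower _ hR)⟩
  rw [← h, ncard_Dir hG hD hUT]
  exact Nat.add_le_add_left (sum_le_sum fun C hC =>
    dpDir_le hG (hD.induce ((isChainGraph_essentialGraph hG hD).subset hC))) _

/-- The greatest size of an equivalence class satisfies the recursion over the chain
components. -/
theorem isGreatest_dpMEC (hG : G.HasChords) (hUT : U ⊆ T) :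
    IsGreatest
      ((fun R : MixedGraph V => ∏ C ∈ R.chainComponents, dpMEC G C (T ∩ C)) ''
        resultSpace (singleNodes U) (inducedGraph G S))
      (dpMEC G S T) := by
  have hupper : ∀ R ∈ resultSpace (singleNodes U) (inducedGraph G S),
      ∏ C ∈ R.chainComponents, dpMEC G C (T ∩ C) ≤ dpMEC G S T := by
    intro R hR
    obtain ⟨D, hD, rfl⟩ := (mem_resultSpace_iff hG).1 hR
    choose E hE hE' using fun C => exists_eq_dpMEC hG C (T ∩ C)
    obtain ⟨D', hD', hess, hind⟩ := exists_isAMO_induce_eq (U := U) hG hD fun C _ => hE C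
    refine (le_of_eq ?_).trans (le_dpMEC hG hD')
    rw [ncard_IMEC hG hD' hUT, hess]
    exact prod_congr rfl fun C hC => by rw [hind C hC, hE']
  refine ⟨?_, Set.forall_mem_image.2 hupper⟩
  obtain ⟨D, hD, h⟩ := exists_eq_dpMEC hG S T
  have hR := (mem_resultSpace_iff (U := U) hG).2 ⟨D, hD, rfl⟩
  refine ⟨_, hR, le_antisymm (hupper _ hR) ?_⟩
  rw [← h, ncard_IMEC hG hD hUT]
  exact prod_le_prod' fun C hC =>
    le_dpMEC hG (hD.induce ((isChainGraph_essentialGraph hG hD).subset hC))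

/-- Acyclic moral orientations of node sets that arise from interventions extend to the whole
graph. -/
theorem exists_isAMO_univ_induce_eq (hG : G.HasChords) (hS : Arises G S) (hD : IsAMO G S D) :
    ∃ D', IsAMO G univ D' ∧ D'.induce S = D := by
  induction hS generalizing D with
  | univ => exact ⟨D, hD, by simp [MixedGraph.induce]⟩
  | @step S C v R _ hv hR hC ih =>
    rw [← singleNodes_singleton] at hR
    obtain ⟨D₀, hD₀, rfl⟩ := (mem_resultSpace_iff hG).1 hR
    have hCG := isChainGraph_essentialGraph (T := {v}) hG hD₀
    -- Extend `D` from `C` to `S` by `D₀` on the other components, then from `S` to the whole graph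
    -- by induction.
    obtain ⟨D₁, hD₁, -, hind⟩ := exists_isAMO_induce_eq (U := {v}) hG hD₀
      (E := fun C' => if C' = C then D else D₀.induce C') fun C' hC' => by
        by_cases h : C' = C
        · subst h
          simpa using hD
        · simpa [h] using hD₀.induce (hCG.subset hC')
    obtain ⟨D', hD', rfl⟩ := ih hD₁
    refine ⟨D', hD', ?_⟩
    have := hind C hC
    rw [if_pos rfl] at this
    rw [← this]
    have hCS := hCG.subset hC
    refine MixedGraph.ext ?_ ?_
    · simp only [MixedGraph.induce, inter_assoc, inter_eq_right.2 hCS]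
    · funext a b
      refine propext ⟨fun ⟨h, ha, hb⟩ => ⟨⟨h, hCS ha, hCS hb⟩, ha, hb⟩, fun h => ⟨h.1.1, h.2⟩⟩

end Recursion

end MixedGraph

theorem proposition2 {V : Type*} [Fintype V] [DecidableEq V] (G : SimpleGraph V)
    (hG : G.HasChords) :
    (∀ (S T : Finset V) (v₁ : V), T ⊆ S → v₁ ∈ T →
      IsLeast
        ((fun R : MixedGraph V =>
            R.Dir.ncard + ∑ C ∈ R.chainComponents, dpDir G C (T ∩ C)) ''
          MixedGraph.resultSpace {{v₁}} (inducedGraph G S))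
        (dpDir G S T)) ∧
    (∀ (S T : Finset V) (v₁ : V), T ⊆ S → v₁ ∈ T →
      IsGreatest
        ((fun R : MixedGraph V => ∏ C ∈ R.chainComponents, dpMEC G C (T ∩ C)) ''
          MixedGraph.resultSpace {{v₁}} (inducedGraph G S))
        (dpMEC G S T)) ∧
    (∀ S : Finset V, Arises G S →
      (fun D : MixedGraph V => D.induce S) '' (MixedGraph.ofGraph G).dags =
        (inducedGraph G S).dags) := by
  refine ⟨fun S T v₁ _ hv => ?_, fun S T v₁ _ hv => ?_, fun S hS => ?_⟩
  · rw [← singleNodes_singleton]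
    exact isLeast_dpDir hG (singleton_subset_iff.2 hv)
  · rw [← singleNodes_singleton]
    exact isGreatest_dpMEC hG (singleton_subset_iff.2 hv)
  · have huniv : ofGraph G = inducedGraph G univ := by
      simp [inducedGraph, MixedGraph.induce, ofGraph]
    ext D
    rw [huniv, mem_dags_inducedGraph_iff hG]
    simp only [Set.mem_image, mem_dags_inducedGraph_iff hG]
    constructor
    · rintro ⟨D', hD', rfl⟩
      exact hD'.induce (subset_univ S)
    · exact exists_isAMO_univ_induce_eq hG hS
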